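/- Let $A\in\mathbb{R}^{n\times n}$ be symmetric positive semidefinite, $b\in\operatorname{range}(A)$, $x^0\in\mathbb{R}^n$, and let $f(x)=\frac12 x^TAx-b^Tx$, $f^*=\inf_{x\in\mathbb{R}^n} f(x)$; this infimum is finite and attained. The conjugate gradient (CG) method sets $r^0=Ax^0-b$, $p^0=-r^0$ and, for $k=0,1,\dots$, while $Ap^k\neq 0$, computes $$\alpha_k=\frac{\|r^k\|^2}{(p^k)^TAp^k},\quad x^{k+1}=x^k+\alpha_kp^k,\quad r^{k+1}=r^k+\alpha_kAp^k,\quad \beta_{k+1}=\frac{\|r^{k+1}\|^2}{\|r^k\|^2},\quad p^{k+1}=-r^{k+1}+\beta_{k+1}p^k,$$ where $\|\cdot\|$ is the Euclidean norm. It terminates at the first $k$ with $Ap^k=0$, and we then set $x^j=x^k$ for all $j\ge k$. Let $\ell=\operatorname{rank}(A)$ and let $\lambda_1\ge\lambda_2\ge\dots\ge\lambda_\ell>0$ be all nonzero eigenvalues of $A$, counted with multiplicity. Then: (i) if $A$ has $\hat\ell$ distinct nonzero eigenvalues, the CG method terminates at a minimizer of $f$ over $\mathbb{R}^n$ in at most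 $\hat\ell$ iterations; (ii) for all $1\le k\le \ell$, $$f(x^k)-f^*\le\left(\frac{\lambda_k-\lambda_\ell}{\lambda_k+\lambda_\ell}\right)^2\bigl(f(x^0)-f^*\bigr);$$ (iii) if $A\ne 0$, then for all $k\ge 0$, $$f(x^k)-f^*\le 4\left(\frac{\sqrt{\kappa(A)}-1}{\sqrt{\kappa(A)}+1}\right)^{2k}\bigl(f(x^0)-f^*\bigr),$$ where $\kappa(A)=\lambda_{\max}(A)/\lambda^+_{\min}(A)$ is the generalized condition number, the ratio of the largest eigenvalue of $A$ to its smallest positive eigenvalue (with the convention $0^0=1$). -/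

import Mathlib

open Matrix

namespace ConvexQP

noncomputable section

/-- The quadratic objective `f(x) = (1/2) xᵀ A x - bᵀ x`. -/
def objective {n : ℕ} (A : Matrix (Fin n) (Fin n) ℝ) (b x : Fin n → ℝ) : ℝ :=
  (1 / 2) * (x ⬝ᵥ (A *ᵥ x)) - b ⬝ᵥ x

/-- The optimal value `f* = inf f(x)` over all `x` in `ℝⁿ`. -/
def optimalValue {n : ℕ} (A : Matrix (Fin n) (Fin n) ℝ) (b : Fin n → ℝ) : ℝ :=
  ⨅ x : Fin n → ℝ, objective A b x

/-- `x` is an optimal solution, that is, a global minimizer of the objective. -/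
def IsOptimal {n : ℕ} (A : Matrix (Fin n) (Fin n) ℝ) (b x : Fin n → ℝ) : Prop :=
  ∀ y : Fin n → ℝ, objective A b x ≤ objective A b y

/-- The variables of the conjugate gradient method: the iterate `x`, the residual `r` and the
search direction `p`. -/
structure CGState (n : ℕ) where
  x : Fin n → ℝ
  r : Fin n → ℝ
  p : Fin n → ℝ

/-- The initialization `r⁰ = A x⁰ - b`, `p⁰ = -r⁰`. -/
def cgInit {n : ℕ} (A : Matrix (Fin n) (Fin n) ℝ) (b x₀ : Fin n → ℝ) : CGState n where
  x := x₀
  r := A *ᵥ x₀ - b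
  p := -(A *ᵥ x₀ - b)

/-- The body of the loop. Here `r ⬝ᵥ r` is the squared Euclidean norm of `r`. -/
def cgUpdate {n : ℕ} (A : Matrix (Fin n) (Fin n) ℝ) (s : CGState n) : CGState n :=
  let α : ℝ := (s.r ⬝ᵥ s.r) / (s.p ⬝ᵥ (A *ᵥ s.p))
  let r' : Fin n → ℝ := s.r + α • (A *ᵥ s.p)
  let β : ℝ := (r' ⬝ᵥ r') / (s.r ⬝ᵥ s.r)
  { x := s.x + α • s.p
    r := r'
    p := -r' + β • s.p }

open Classical in
/-- The state of the method after `k` passes through the loop `while A p ≠ 0`. Once the method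
has stopped, the state no longer changes. -/
def cgState {n : ℕ} (A : Matrix (Fin n) (Fin n) ℝ) (b x₀ : Fin n → ℝ) : ℕ → CGState n
  | 0 => cgInit A b x₀
  | k + 1 =>
      if A *ᵥ (cgState A b x₀ k).p ≠ 0 then cgUpdate A (cgState A b x₀ k)
      else cgState A b x₀ k

/-- The iterate `xᵏ`. -/
def cgIterate {n : ℕ} (A : Matrix (Fin n) (Fin n) ℝ) (b x₀ : Fin n → ℝ) (k : ℕ) : Fin n → ℝ :=
  (cgState A b x₀ k).x

/-- The method stops after exactly `k` iterations: `k` is the first index with `A pᵏ = 0`. -/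
def CGTerminatesAt {n : ℕ} (A : Matrix (Fin n) (Fin n) ℝ) (b x₀ : Fin n → ℝ) (k : ℕ) : Prop :=
  A *ᵥ (cgState A b x₀ k).p = 0 ∧ ∀ j < k, A *ᵥ (cgState A b x₀ j).p ≠ 0

/-- The number of distinct nonzero eigenvalues of `A`. -/
def numDistinctNonzeroEigenvalues {n : ℕ} (A : Matrix (Fin n) (Fin n) ℝ) : ℕ :=
  {μ : ℝ | μ ∈ spectrum ℝ A ∧ μ ≠ 0}.ncard

/-- `lam 1 ≥ lam 2 ≥ ⋯ ≥ lam ℓ`, with `ℓ = rank A`, are all the nonzero eigenvalues of the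
symmetric matrix `A`, repeated according to multiplicity. -/
def AreNonzeroEigenvalues {n : ℕ} (A : Matrix (Fin n) (Fin n) ℝ) (lam : ℕ → ℝ) : Prop :=
  AntitoneOn lam (Set.Icc 1 A.rank) ∧
    (Finset.Icc 1 A.rank).val.map lam = A.charpoly.roots.filter (fun μ => μ ≠ 0)

/-- The generalized condition number of a nonzero symmetric positive semidefinite matrix: its
largest eigenvalue divided by its smallest positive eigenvalue. -/
def genCondNumber {n : ℕ} (A : Matrix (Fin n) (Fin n) ℝ) : ℝ :=
  sSup (spectrum ℝ A) / sInf {μ : ℝ | μ ∈ spectrum ℝ A ∧ 0 < μ}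

end

end ConvexQP

/-! Orthogonality of the residuals and conjugacy of the directions (`IsCGRecursion.orthogonality`)
make `r k` orthogonal to all earlier directions, and their span contains the Krylov vectors `A ^ i
*ᵥ r 0` for `i < k`. Let `A *ᵥ z = b`. The gap `f(x) - f*` is half the squared `A`-seminorm of `x -
z`. By Pythagoras, `xᵏ` does at least as well as any point with error `q(A)(x₀ - z)`, where `deg q ≤
k` and `q(0) = 1`. Diagonalizing `A` bounds the gap by the square of the largest `|q|` over the
nonzero eigenvalues (`objective_cgIterate_sub_le`).

Each claim is then a choice of `q`: (i) vanishing at every nonzero eigenvalue; (ii) vanishing at the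
`k - 1` largest, times a linear factor balanced on the remaining interval; (iii) a shifted Chebyshev
polynomial. -/

namespace ConvexQP

variable {n : ℕ}

/-! ### Orthogonality, conjugacy and Krylov spaces -/

section Recursion

/-- The coupled two-term recursion behind the conjugate gradient method, with step lengths `α` and
`β` characterized by relations that stay valid after the residual has vanished. -/
structure IsCGRecursion (A : Matrix (Fin n) (Fin n) ℝ) (α β : ℕ → ℝ) (r p : ℕ → Fin n → ℝ) :
    Prop where
  p_zero : p 0 = -r 0
  r_succ : ∀ k, r (k + 1) = r k + α k • (A *ᵥ p k)
  p_succ : ∀ k, p (k + 1) = -r (k + 1) + β k • p k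
  alpha_mul : ∀ k, α k * (p k ⬝ᵥ (A *ᵥ p k)) = r k ⬝ᵥ r k
  beta_mul : ∀ k, β k * (r k ⬝ᵥ r k) = r (k + 1) ⬝ᵥ r (k + 1)
  p_eq_zero : ∀ k, α k = 0 → p k = 0

variable {A : Matrix (Fin n) (Fin n) ℝ} {α β : ℕ → ℝ} {r p : ℕ → Fin n → ℝ}

lemma dotProduct_mulVec_comm_of_isHermitian (hA : A.IsHermitian) (u v : Fin n → ℝ) :
    u ⬝ᵥ (A *ᵥ v) = v ⬝ᵥ (A *ᵥ u) := by
  have hT : Aᵀ = A := by rw [← conjTranspose_eq_transpose_of_trivial]; exact hA.eq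
  rw [dotProduct_mulVec, ← mulVec_transpose, hT, dotProduct_comm]

/-- All relations go through one induction: the choice of `α` gives orthogonality to the new
residual, and the choice of `β` gives conjugacy of the new direction. -/
theorem IsCGRecursion.orthogonality (h : IsCGRecursion A α β r p) (hA : A.IsHermitian) (k : ℕ) :
    p k ⬝ᵥ r k = -(r k ⬝ᵥ r k) ∧
      ∀ i < k, r i ⬝ᵥ r k = 0 ∧ p i ⬝ᵥ r k = 0 ∧ p i ⬝ᵥ (A *ᵥ p k) = 0 := by
  induction k with
  | zero => simp [h.p_zero]
  | succ k ih =>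
    obtain ⟨hpr, ih⟩ := ih
    have hp : ∀ i < k + 1, p i ⬝ᵥ r (k + 1) = 0 := by
      intro i hi
      rw [h.r_succ, dotProduct_add, dotProduct_smul, smul_eq_mul]
      rcases Nat.lt_succ_iff_lt_or_eq.mp hi with hi | rfl
      · rw [(ih i hi).2.1, (ih i hi).2.2]; ring
      · rw [hpr, h.alpha_mul]; ring
    have hr : ∀ i < k + 1, r i ⬝ᵥ r (k + 1) = 0 := by
      intro i hi
      cases i with
      | zero =>
        have := hp 0 hi
        rwa [h.p_zero, neg_dotProduct, neg_eq_zero] at this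
      | succ i =>
        have h1 := hp (i + 1) hi
        rw [h.p_succ, add_dotProduct, smul_dotProduct, neg_dotProduct, hp i (by omega)] at h1
        simpa using h1
    refine ⟨?_, fun i hi => ⟨hr i hi, hp i hi, ?_⟩⟩
    · nth_rw 1 [h.p_succ]
      rw [add_dotProduct, smul_dotProduct, neg_dotProduct, hp k (by omega)]
      simp
    · by_cases hα : α i = 0
      · simp [h.p_eq_zero i hα]
      -- Since `α i • A *ᵥ p i = r (i + 1) - r i`, an `A`-product becomes a product of residuals.
      have h1 : α i * (p i ⬝ᵥ (A *ᵥ r (k + 1))) = r (i + 1) ⬝ᵥ r (k + 1) := by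
        rw [dotProduct_mulVec_comm_of_isHermitian hA, dotProduct_comm (r (i + 1)), h.r_succ i,
          dotProduct_add, dotProduct_smul, smul_eq_mul, dotProduct_comm (r (k + 1)) (r i), hr i hi,
          zero_add]
      refine (mul_eq_zero.mp ?_).resolve_left hα
      rw [h.p_succ, mulVec_add, mulVec_neg, mulVec_smul, dotProduct_add, dotProduct_neg,
        dotProduct_smul, smul_eq_mul, mul_add, mul_neg, h1]
      rcases Nat.lt_succ_iff_lt_or_eq.mp hi with hi | rfl
      · rw [hr (i + 1) (by omega), (ih i hi).2.2]; ring
      · rw [← mul_assoc, mul_comm (α i), mul_assoc, h.alpha_mul, h.beta_mul]; ring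

/-- The span of the first `k` search directions. -/
def searchSpace (p : ℕ → Fin n → ℝ) (k : ℕ) : Submodule ℝ (Fin n → ℝ) :=
  Submodule.span ℝ (p '' Set.Iio k)

lemma mem_searchSpace {p : ℕ → Fin n → ℝ} {i k : ℕ} (hik : i < k) : p i ∈ searchSpace p k :=
  Submodule.subset_span ⟨i, hik, rfl⟩

lemma searchSpace_mono (p : ℕ → Fin n → ℝ) : Monotone (searchSpace p) := fun _ _ h =>
  Submodule.span_mono (Set.image_mono (Set.Iio_subset_Iio h))

lemma IsCGRecursion.r_mem_searchSpace (h : IsCGRecursion A α β r p) (k : ℕ) :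
    r k ∈ searchSpace p (k + 1) := by
  cases k with
  | zero =>
    rw [← neg_neg (r 0), ← h.p_zero]
    exact neg_mem (mem_searchSpace (by omega))
  | succ k =>
    have : r (k + 1) = β k • p k - p (k + 1) := by rw [h.p_succ]; abel
    rw [this]
    exact sub_mem (Submodule.smul_mem _ _ (mem_searchSpace (by omega)))
      (mem_searchSpace (by omega))

/-- `A *ᵥ p i` is a multiple of `r (i + 1) - r i`, and each residual is a combination of two
consecutive directions. -/
lemma IsCGRecursion.mulVec_mem_searchSpace (h : IsCGRecursion A α β r p) {k : ℕ}
    {v : Fin n → ℝ} (hv : v ∈ searchSpace p k) : A *ᵥ v ∈ searchSpace p (k + 1) := by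
  induction hv using Submodule.span_induction with
  | mem v hv =>
    obtain ⟨i, hi, rfl⟩ := hv
    have hi : i < k := hi
    by_cases hα : α i = 0
    · simp [h.p_eq_zero i hα]
    have : A *ᵥ p i = (α i)⁻¹ • (r (i + 1) - r i) := by
      rw [h.r_succ, add_sub_cancel_left, smul_smul, inv_mul_cancel₀ hα, one_smul]
    rw [this]
    exact Submodule.smul_mem _ _ (sub_mem
      (searchSpace_mono p (by omega) (h.r_mem_searchSpace (i + 1)))
      (searchSpace_mono p (by omega) (h.r_mem_searchSpace i)))
  | zero => simp
  | add u v _ _ hu hv => rw [mulVec_add]; exact add_mem hu hv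
  | smul a v _ hv => rw [mulVec_smul]; exact Submodule.smul_mem _ _ hv

lemma IsCGRecursion.pow_mulVec_mem_searchSpace (h : IsCGRecursion A α β r p) (k : ℕ) :
    (A ^ k) *ᵥ r 0 ∈ searchSpace p (k + 1) := by
  induction k with
  | zero => simpa using h.r_mem_searchSpace 0
  | succ k ih =>
    rw [pow_succ', ← mulVec_mulVec]
    exact h.mulVec_mem_searchSpace ih

/-- The condition on coefficients, unlike a bound on `natDegree`, expresses degree below `k` even
for `k = 0`, where it forces `s = 0`. -/
lemma IsCGRecursion.aeval_mulVec_mem_searchSpace (h : IsCGRecursion A α β r p) {k : ℕ}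
    {s : Polynomial ℝ} (hs : ∀ i, k ≤ i → s.coeff i = 0) :
    (Polynomial.aeval A s) *ᵥ r 0 ∈ searchSpace p k := by
  rw [Polynomial.aeval_eq_sum_range, sum_mulVec]
  refine sum_mem fun i _ => ?_
  by_cases hi : k ≤ i
  · simp [hs i hi]
  · rw [smul_mulVec]
    exact Submodule.smul_mem _ _
      (searchSpace_mono p (by omega) (h.pow_mulVec_mem_searchSpace i))

lemma IsCGRecursion.dotProduct_r_eq_zero (h : IsCGRecursion A α β r p) (hA : A.IsHermitian)
    {k : ℕ} {v : Fin n → ℝ} (hv : v ∈ searchSpace p k) : v ⬝ᵥ r k = 0 := by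
  induction hv using Submodule.span_induction with
  | mem v hv =>
    obtain ⟨i, hi, rfl⟩ := hv
    exact ((h.orthogonality hA k).2 i hi).2.1
  | zero => simp
  | add u v _ _ hu hv => rw [add_dotProduct, hu, hv, add_zero]
  | smul a v _ hv => rw [smul_dotProduct, hv, smul_zero]

end Recursion

/-! ### The algorithm as an instance of the recursion -/

section State

variable {A : Matrix (Fin n) (Fin n) ℝ}

/-- Range and kernel of a symmetric matrix are orthogonal. -/
lemma eq_zero_of_mulVec_eq_zero_of_mem_range (hA : A.IsHermitian) {v w : Fin n → ℝ}
    (hv : v = A *ᵥ w) (h : A *ᵥ v = 0) : v = 0 := by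
  rw [← dotProduct_self_eq_zero]
  nth_rw 2 [hv]
  rw [dotProduct_mulVec_comm_of_isHermitian hA, h, dotProduct_zero]

lemma mulVec_eq_zero_of_dotProduct_eq_zero (hA : A.PosSemidef) {v : Fin n → ℝ}
    (h : v ⬝ᵥ (A *ᵥ v) = 0) : A *ᵥ v = 0 := by
  simpa using (hA.dotProduct_mulVec_zero_iff v).mp (by simpa using h)

/-- One pass of the conjugate gradient loop is neutral on a state with vanishing residual and
search direction. -/
lemma cgUpdate_of_eq_zero {s : CGState n} (hr : s.r = 0) (hp : s.p = 0) : cgUpdate A s = s := by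
  obtain ⟨x, r, p⟩ := s
  simp only at hr hp
  subst hr hp
  simp [cgUpdate]

/-- The loop invariants that do not involve earlier iterations. -/
theorem cgState_invariant (hA : A.PosSemidef) {b : Fin n → ℝ} (x₀ : Fin n → ℝ)
    (hb : ∃ z, A *ᵥ z = b) (k : ℕ) :
    let s := cgState A b x₀ k
    s.r = A *ᵥ s.x - b ∧ s.p ⬝ᵥ s.r = -(s.r ⬝ᵥ s.r) ∧ (s.r = 0 → s.p = 0) ∧
      ∃ w, s.p = A *ᵥ w := by
  obtain ⟨z, rfl⟩ := hb
  induction k with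
  | zero =>
    refine ⟨rfl, neg_dotProduct _ _, fun h => ?_, z - x₀, ?_⟩
    · exact neg_eq_zero.mpr h
    · simp [cgState, cgInit, mulVec_sub]
  | succ k ih =>
    simp only [cgState]
    split_ifs with hAp
    · simp only at ih
      set s := cgState A (A *ᵥ z) x₀ k
      obtain ⟨hr, hpr, -, w, hw⟩ := ih
      have hpAp : s.p ⬝ᵥ (A *ᵥ s.p) ≠ 0 := fun h =>
        hAp (mulVec_eq_zero_of_dotProduct_eq_zero hA h)
      have hr' : (cgUpdate A s).r = A *ᵥ (cgUpdate A s).x - A *ᵥ z := by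
        simp only [cgUpdate, mulVec_add, mulVec_smul]
        rw [hr]; abel
      have hpr' : s.p ⬝ᵥ (cgUpdate A s).r = 0 := by
        simp only [cgUpdate, dotProduct_add, dotProduct_smul, smul_eq_mul]
        rw [hpr, div_mul_cancel₀ _ hpAp]; ring
      have hp' : (cgUpdate A s).p = -(cgUpdate A s).r +
        (((cgUpdate A s).r ⬝ᵥ (cgUpdate A s).r) / (s.r ⬝ᵥ s.r)) • s.p := rfl
      refine ⟨hr', ?_, ?_, ?_⟩
      · rw [hp', add_dotProduct, smul_dotProduct, hpr', neg_dotProduct]; simp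
      · intro h; rw [hp', h]; simp
      · refine ⟨-((cgUpdate A s).x - z) +
          (((cgUpdate A s).r ⬝ᵥ (cgUpdate A s).r) / (s.r ⬝ᵥ s.r)) • w, ?_⟩
        rw [hp', mulVec_add, mulVec_neg, mulVec_smul, mulVec_sub, ← hr', ← hw]
    · exact ih

lemma cgState_r (hA : A.PosSemidef) {b : Fin n → ℝ} (x₀ : Fin n → ℝ)
    (hb : ∃ z, A *ᵥ z = b) (k : ℕ) :
    (cgState A b x₀ k).r = A *ᵥ cgIterate A b x₀ k - b := (cgState_invariant hA x₀ hb k).1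

lemma cgState_p_eq_zero_iff (hA : A.PosSemidef) {b : Fin n → ℝ} (x₀ : Fin n → ℝ)
    (hb : ∃ z, A *ᵥ z = b) (k : ℕ) :
    (cgState A b x₀ k).p = 0 ↔ (cgState A b x₀ k).r = 0 := by
  obtain ⟨-, h1, h2, -⟩ := cgState_invariant hA x₀ hb k
  refine ⟨fun h => ?_, h2⟩
  rw [h, zero_dotProduct, eq_comm, neg_eq_zero] at h1
  exact dotProduct_self_eq_zero.mp h1

/-- The stopping test `A p = 0` is passed exactly when the residual vanishes. -/
lemma mulVec_cgState_p_eq_zero_iff (hA : A.PosSemidef) {b : Fin n → ℝ} (x₀ : Fin n → ℝ)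
    (hb : ∃ z, A *ᵥ z = b) (k : ℕ) :
    A *ᵥ (cgState A b x₀ k).p = 0 ↔ (cgState A b x₀ k).r = 0 := by
  rw [← cgState_p_eq_zero_iff hA x₀ hb]
  obtain ⟨-, -, -, w, hw⟩ := cgState_invariant hA x₀ hb k
  exact ⟨eq_zero_of_mulVec_eq_zero_of_mem_range hA.1 hw, fun h => by rw [h, mulVec_zero]⟩

/-- The loop test can be dropped: at termination residual and direction are both zero, so a further
pass changes nothing. -/
lemma cgState_succ (hA : A.PosSemidef) {b : Fin n → ℝ} (x₀ : Fin n → ℝ)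
    (hb : ∃ z, A *ᵥ z = b) (k : ℕ) :
    cgState A b x₀ (k + 1) = cgUpdate A (cgState A b x₀ k) := by
  rw [cgState]
  split_ifs with h
  · rfl
  · rw [not_not, mulVec_cgState_p_eq_zero_iff hA x₀ hb] at h
    exact (cgUpdate_of_eq_zero h ((cgState_p_eq_zero_iff hA x₀ hb k).mpr h)).symm

/-- The step length used in iteration `k`. -/
noncomputable def cgStep (A : Matrix (Fin n) (Fin n) ℝ) (b x₀ : Fin n → ℝ) (k : ℕ) : ℝ :=
  ((cgState A b x₀ k).r ⬝ᵥ (cgState A b x₀ k).r) /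
    ((cgState A b x₀ k).p ⬝ᵥ (A *ᵥ (cgState A b x₀ k).p))

lemma cgIterate_succ (hA : A.PosSemidef) {b : Fin n → ℝ} (x₀ : Fin n → ℝ)
    (hb : ∃ z, A *ᵥ z = b) (k : ℕ) :
    cgIterate A b x₀ (k + 1) = cgIterate A b x₀ k + cgStep A b x₀ k • (cgState A b x₀ k).p := by
  rw [cgIterate, cgState_succ hA x₀ hb]; rfl

theorem isCGRecursion_cgState (hA : A.PosSemidef) {b : Fin n → ℝ} (x₀ : Fin n → ℝ)
    (hb : ∃ z, A *ᵥ z = b) :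
    IsCGRecursion A (cgStep A b x₀)
      (fun k => ((cgState A b x₀ (k + 1)).r ⬝ᵥ (cgState A b x₀ (k + 1)).r) /
        ((cgState A b x₀ k).r ⬝ᵥ (cgState A b x₀ k).r))
      (fun k => (cgState A b x₀ k).r) (fun k => (cgState A b x₀ k).p) where
  p_zero := rfl
  r_succ k := by rw [cgState_succ hA x₀ hb]; rfl
  p_succ k := by simp only [cgState_succ hA x₀ hb k]; rfl
  alpha_mul k := by
    by_cases h : (cgState A b x₀ k).p ⬝ᵥ (A *ᵥ (cgState A b x₀ k).p) = 0
    · rw [(mulVec_cgState_p_eq_zero_iff hA x₀ hb k).mp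
        (mulVec_eq_zero_of_dotProduct_eq_zero hA h), h]
      simp
    · exact div_mul_cancel₀ _ h
  beta_mul k := by
    by_cases h : (cgState A b x₀ k).r ⬝ᵥ (cgState A b x₀ k).r = 0
    · have hr := dotProduct_self_eq_zero.mp h
      have hp := (cgState_p_eq_zero_iff hA x₀ hb k).mpr hr
      rw [cgState_succ hA x₀ hb, cgUpdate_of_eq_zero hr hp, h, mul_zero]
    · exact div_mul_cancel₀ _ h
  p_eq_zero k hk := by
    -- The quotient is also zero when its denominator is; semidefiniteness then gives `A p = 0`, so
    -- the residual vanishes in either case.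
    rw [cgStep, div_eq_zero_iff] at hk
    rw [cgState_p_eq_zero_iff hA x₀ hb]
    rcases hk with h | h
    · exact dotProduct_self_eq_zero.mp h
    · exact (mulVec_cgState_p_eq_zero_iff hA x₀ hb k).mp
        (mulVec_eq_zero_of_dotProduct_eq_zero hA h)

lemma cgIterate_sub_mem_searchSpace (hA : A.PosSemidef) {b : Fin n → ℝ} (x₀ : Fin n → ℝ)
    (hb : ∃ z, A *ᵥ z = b) (k : ℕ) :
    cgIterate A b x₀ k - x₀ ∈ searchSpace (fun k => (cgState A b x₀ k).p) k := by
  induction k with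
  | zero => simp [cgIterate, cgState, cgInit]
  | succ k ih =>
    rw [cgIterate_succ hA x₀ hb, add_sub_right_comm]
    exact add_mem (searchSpace_mono _ k.le_succ ih)
      (Submodule.smul_mem _ _ (mem_searchSpace (p := fun k => (cgState A b x₀ k).p) k.lt_succ_self))

end State

/-! ### The optimality gap as an `A`-seminorm -/

section Objective

variable {A : Matrix (Fin n) (Fin n) ℝ}

lemma objective_sub_objective (hA : A.IsHermitian) (x z : Fin n → ℝ) :
    objective A (A *ᵥ z) x - objective A (A *ᵥ z) z = 1 / 2 * ((x - z) ⬝ᵥ (A *ᵥ (x - z))) := by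
  have h1 := dotProduct_mulVec_comm_of_isHermitian hA z x
  simp only [objective, mulVec_sub, dotProduct_sub, sub_dotProduct]
  rw [dotProduct_comm (A *ᵥ z) x, dotProduct_comm (A *ᵥ z) z, h1]
  ring

lemma dotProduct_mulVec_self_nonneg (hA : A.PosSemidef) (v : Fin n → ℝ) :
    0 ≤ v ⬝ᵥ (A *ᵥ v) := by simpa using hA.dotProduct_mulVec_nonneg v

lemma isOptimal_of_mulVec_eq (hA : A.PosSemidef) {b z : Fin n → ℝ} (hz : A *ᵥ z = b) :
    IsOptimal A b z := by
  subst hz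
  intro y
  have := objective_sub_objective hA.1 y z
  have := dotProduct_mulVec_self_nonneg hA (y - z)
  linarith

lemma IsOptimal.isLeast {b z : Fin n → ℝ} (h : IsOptimal A b z) :
    IsLeast (Set.range (objective A b)) (objective A b z) :=
  ⟨⟨z, rfl⟩, by rintro _ ⟨y, rfl⟩; exact h y⟩

lemma IsOptimal.optimalValue_eq {b z : Fin n → ℝ} (h : IsOptimal A b z) :
    optimalValue A b = objective A b z := h.isLeast.csInf_eq

lemma objective_sub_optimalValue (hA : A.PosSemidef) {b z : Fin n → ℝ} (hz : A *ᵥ z = b)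
    (x : Fin n → ℝ) :
    objective A b x - optimalValue A b = 1 / 2 * ((x - z) ⬝ᵥ (A *ᵥ (x - z))) := by
  rw [(isOptimal_of_mulVec_eq hA hz).optimalValue_eq]
  subst hz
  exact objective_sub_objective hA.1 x z

end Objective

/-! ### Polynomials in `A` on an eigenbasis -/

section Spectral

variable {A : Matrix (Fin n) (Fin n) ℝ}

/-- The coordinates of a vector in an orthonormal eigenbasis. -/
noncomputable def eigenCoord (hA : A.IsHermitian) (i : Fin n) (v : Fin n → ℝ) : ℝ :=
  v ⬝ᵥ (hA.eigenvectorBasis i).ofLp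

lemma eigenCoord_mulVec (hA : A.IsHermitian) (i : Fin n) (v : Fin n → ℝ) :
    eigenCoord hA i (A *ᵥ v) = hA.eigenvalues i * eigenCoord hA i v := by
  rw [eigenCoord, dotProduct_comm, dotProduct_mulVec_comm_of_isHermitian hA,
    hA.mulVec_eigenvectorBasis, dotProduct_smul, smul_eq_mul, eigenCoord]

lemma eigenCoord_aeval_mulVec (hA : A.IsHermitian) (i : Fin n) (q : Polynomial ℝ)
    (v : Fin n → ℝ) :
    eigenCoord hA i (Polynomial.aeval A q *ᵥ v) =
      q.eval (hA.eigenvalues i) * eigenCoord hA i v := by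
  induction q using Polynomial.induction_on' with
  | add p q hp hq =>
    simp only [eigenCoord] at hp hq ⊢
    rw [map_add, add_mulVec, add_dotProduct, hp, hq, Polynomial.eval_add, add_mul]
  | monomial k a =>
    rw [Polynomial.aeval_monomial, Polynomial.eval_monomial, ← Algebra.smul_def, smul_mulVec]
    have hpow : ∀ k : ℕ, eigenCoord hA i ((A ^ k) *ᵥ v) =
        hA.eigenvalues i ^ k * eigenCoord hA i v := by
      intro k
      induction k with
      | zero => simp
      | succ k ih => rw [pow_succ', ← mulVec_mulVec, eigenCoord_mulVec, ih]; ring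
    have := hpow k
    rw [eigenCoord] at this ⊢
    rw [smul_dotProduct, this, smul_eq_mul, mul_assoc]

lemma dotProduct_eq_sum_eigenCoord (hA : A.IsHermitian) (v w : Fin n → ℝ) :
    v ⬝ᵥ w = ∑ i, eigenCoord hA i v * eigenCoord hA i w := by
  have := hA.eigenvectorBasis.sum_inner_mul_inner (WithLp.toLp 2 v) (WithLp.toLp 2 w)
  simp only [EuclideanSpace.inner_eq_star_dotProduct, star_trivial] at this
  rw [dotProduct_comm, ← this]
  refine Finset.sum_congr rfl fun i _ => ?_
  rw [eigenCoord, eigenCoord, dotProduct_comm v]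

lemma dotProduct_mulVec_self_eq_sum (hA : A.IsHermitian) (v : Fin n → ℝ) :
    v ⬝ᵥ (A *ᵥ v) = ∑ i, hA.eigenvalues i * eigenCoord hA i v ^ 2 := by
  rw [dotProduct_eq_sum_eigenCoord hA]
  refine Finset.sum_congr rfl fun i _ => ?_
  rw [eigenCoord_mulVec]; ring

/-- Components in the kernel have weight zero in the `A`-seminorm, so no bound on `q` at the
eigenvalue `0` is needed. -/
theorem dotProduct_mulVec_aeval_le (hA : A.PosSemidef) {q : Polynomial ℝ} {M : ℝ}
    (hM : ∀ μ ∈ spectrum ℝ A, μ ≠ 0 → |q.eval μ| ≤ M) (v : Fin n → ℝ) :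
    (Polynomial.aeval A q *ᵥ v) ⬝ᵥ (A *ᵥ (Polynomial.aeval A q *ᵥ v)) ≤
      M ^ 2 * (v ⬝ᵥ (A *ᵥ v)) := by
  rw [dotProduct_mulVec_self_eq_sum hA.1, dotProduct_mulVec_self_eq_sum hA.1, Finset.mul_sum]
  refine Finset.sum_le_sum fun i _ => ?_
  rw [eigenCoord_aeval_mulVec]
  have h0 : 0 ≤ hA.1.eigenvalues i := hA.eigenvalues_nonneg i
  rcases eq_or_ne (hA.1.eigenvalues i) 0 with h | h
  · simp [h]
  have h2 : q.eval (hA.1.eigenvalues i) ^ 2 ≤ M ^ 2 :=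
    sq_le_sq.mpr ((hM _ (hA.1.eigenvalues_mem_spectrum_real i) h).trans (le_abs_self M))
  calc _ = q.eval (hA.1.eigenvalues i) ^ 2 *
          (hA.1.eigenvalues i * eigenCoord hA.1 i v ^ 2) := by ring
    _ ≤ _ := by gcongr

lemma nonneg_of_mem_spectrum (hA : A.PosSemidef) {μ : ℝ} (hμ : μ ∈ spectrum ℝ A) : 0 ≤ μ := by
  rw [hA.1.spectrum_real_eq_range_eigenvalues] at hμ
  obtain ⟨i, rfl⟩ := hμ
  exact hA.eigenvalues_nonneg i

end Spectral

/-! ### Polynomial optimality of the iterates -/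

variable {A : Matrix (Fin n) (Fin n) ℝ}

/-- The `k`-th conjugate gradient iterate is at least as good as every polynomial in `A` of degree
at most `k` with constant coefficient one applied to the initial error. -/
theorem objective_cgIterate_sub_le (hA : A.PosSemidef) {b : Fin n → ℝ} (x₀ : Fin n → ℝ)
    (hb : ∃ z, A *ᵥ z = b) {k : ℕ} {q : Polynomial ℝ} (hdeg : q.natDegree ≤ k)
    (hq : q.eval 0 = 1) {M : ℝ} (hM : ∀ μ ∈ spectrum ℝ A, μ ≠ 0 → |q.eval μ| ≤ M) :
    objective A b (cgIterate A b x₀ k) - optimalValue A b ≤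
      M ^ 2 * (objective A b x₀ - optimalValue A b) := by
  obtain ⟨z, hz⟩ := id hb
  have hrec := isCGRecursion_cgState hA x₀ hb
  rw [objective_sub_optimalValue hA hz, objective_sub_optimalValue hA hz]
  set xk := cgIterate A b x₀ k
  have hr0 : (cgState A b x₀ 0).r = A *ᵥ (x₀ - z) := by
    rw [mulVec_sub, hz]; rfl
  have hrk : (cgState A b x₀ k).r = A *ᵥ (xk - z) := by
    rw [mulVec_sub, hz, cgState_r hA x₀ hb]
  -- The displacement from `xᵏ` to the competitor with error `q(A)(x₀ - z)`, using `q = q.divX * X +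
  -- 1`.
  set d : Fin n → ℝ := Polynomial.aeval A q.divX *ᵥ (A *ᵥ (x₀ - z)) - (xk - x₀) with hd_def
  have hd : d ⬝ᵥ (A *ᵥ (xk - z)) = 0 := by
    rw [← hrk]
    refine hrec.dotProduct_r_eq_zero hA.1 (sub_mem ?_ (cgIterate_sub_mem_searchSpace hA x₀ hb k))
    rw [← hr0]
    refine hrec.aeval_mulVec_mem_searchSpace fun i hi => ?_
    rw [Polynomial.coeff_divX]
    exact Polynomial.coeff_eq_zero_of_natDegree_lt (by omega)
  have hqe : Polynomial.aeval A q *ᵥ (x₀ - z) = (xk - z) + d := by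
    have h1 : Polynomial.aeval A q = Polynomial.aeval A q.divX * A + 1 := by
      conv_lhs => rw [← Polynomial.divX_mul_X_add q]
      rw [Polynomial.coeff_zero_eq_eval_zero, hq]
      simp
    rw [h1, add_mulVec, one_mulVec, ← mulVec_mulVec, hd_def]
    abel
  have hle := dotProduct_mulVec_aeval_le hA hM (x₀ - z)
  have hdd := dotProduct_mulVec_self_nonneg hA d
  rw [hqe, mulVec_add, dotProduct_add, add_dotProduct, add_dotProduct, hd,
    dotProduct_mulVec_comm_of_isHermitian hA.1 (xk - z) d, hd] at hle
  linarith

/-! ### Residual polynomials and Chebyshev bounds -/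

section Polynomials

open Polynomial

lemma natDegree_one_sub_C_mul_X_le (a : ℝ) : (1 - C a * X : ℝ[X]).natDegree ≤ 1 := by
  refine (natDegree_sub_le _ _).trans ?_
  simpa using (natDegree_C_mul_le a X).trans natDegree_X_le

/-- The polynomial with roots `f i`, normalized to take the value one at the origin. -/
noncomputable def residualPoly {ι : Type*} (S : Finset ι) (f : ι → ℝ) : ℝ[X] :=
  ∏ i ∈ S, (1 - C (f i)⁻¹ * X)

lemma natDegree_residualPoly_le {ι : Type*} (S : Finset ι) (f : ι → ℝ) :
    (residualPoly S f).natDegree ≤ S.card := by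
  refine (natDegree_prod_le _ _).trans ?_
  simpa using Finset.sum_le_card_nsmul S _ 1 fun i _ => natDegree_one_sub_C_mul_X_le (f i)⁻¹

lemma eval_residualPoly {ι : Type*} (S : Finset ι) (f : ι → ℝ) (t : ℝ) :
    (residualPoly S f).eval t = ∏ i ∈ S, (1 - (f i)⁻¹ * t) := by
  simp [residualPoly, eval_prod]

lemma eval_residualPoly_eq_zero {ι : Type*} {S : Finset ι} {f : ι → ℝ} {i : ι} (hi : i ∈ S)
    (hf : f i ≠ 0) : (residualPoly S f).eval (f i) = 0 := by
  rw [eval_residualPoly]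
  exact Finset.prod_eq_zero hi (by rw [inv_mul_cancel₀ hf, sub_self])

lemma abs_eval_residualPoly_le_one {ι : Type*} {S : Finset ι} {f : ι → ℝ} {t : ℝ} (ht : 0 < t)
    (hf : ∀ i ∈ S, t ≤ f i) : |(residualPoly S f).eval t| ≤ 1 := by
  rw [eval_residualPoly, Finset.abs_prod]
  refine Finset.prod_le_one (fun _ _ => abs_nonneg _) fun i hi => ?_
  have hfi : 0 < f i := ht.trans_le (hf i hi)
  have h1 : (f i)⁻¹ * t ≤ 1 := by
    rw [inv_mul_le_iff₀ hfi, mul_one]; exact hf i hi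
  have h2 : 0 ≤ (f i)⁻¹ * t := by positivity
  rw [abs_le]; constructor <;> linarith

lemma abs_one_sub_le_of_mem_Icc {c a t : ℝ} (hc : 0 < c) (h1 : c ≤ t) (h2 : t ≤ a) :
    |1 - 2 / (a + c) * t| ≤ (a - c) / (a + c) := by
  have hac : 0 < a + c := by linarith
  have : 1 - 2 / (a + c) * t = (a + c - 2 * t) / (a + c) := by field_simp
  rw [this, abs_div, abs_of_pos hac]
  gcongr
  rw [abs_le]; constructor <;> linarith

lemma half_pow_le_cosh {ρ : ℝ} (hρ : 0 < ρ) (k : ℕ) :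
    (2 * ρ ^ k)⁻¹ ≤ Real.cosh (k * -Real.log ρ) := by
  rw [Real.cosh_eq]
  have h1 : Real.exp (k * -Real.log ρ) = (ρ ^ k)⁻¹ := by
    rw [mul_neg, Real.exp_neg, ← Real.log_pow, Real.exp_log (by positivity)]
  have h2 := (Real.exp_pos (-(k * -Real.log ρ))).le
  rw [h1, mul_inv]
  linarith

lemma abs_eval_T_le_one (k : ℕ) {x : ℝ} (hx : |x| ≤ 1) :
    |(Chebyshev.T ℝ k).eval x| ≤ 1 := by
  rw [abs_le] at hx
  rw [← Real.cos_arccos hx.1 hx.2, Chebyshev.T_real_cos]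
  exact Real.abs_cos_le_one _

/-- Shifted Chebyshev polynomials are small on `[m, L]` and take the value one at the origin. -/
theorem exists_chebyshev_residual {m L : ℝ} (hm : 0 < m) (hmL : m ≤ L) (k : ℕ) :
    ∃ q : ℝ[X], q.natDegree ≤ k ∧ q.eval 0 = 1 ∧
      ∀ t, m ≤ t → t ≤ L → |q.eval t| ≤ 2 * ((√(L / m) - 1) / (√(L / m) + 1)) ^ k := by
  -- If `m = L` the affine map onto `[-1, 1]` degenerates and the bound is `2 * 0 ^ k`: nonzero for
  -- `k = 0`, otherwise met by a linear factor with root `m`.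
  rcases hmL.eq_or_lt with rfl | hlt
  · rw [div_self hm.ne', Real.sqrt_one, sub_self, zero_div]
    cases k with
    | zero => exact ⟨1, by simp, by simp, by simp⟩
    | succ k =>
      refine ⟨1 - C m⁻¹ * X, (natDegree_one_sub_C_mul_X_le _).trans (by omega), by simp,
        fun t h1 h2 => ?_⟩
      obtain rfl := le_antisymm h2 h1
      simp [hm.ne']
  set s := √(L / m) with hs_def
  have hs1 : 1 < s := by
    rw [hs_def, Real.lt_sqrt zero_le_one, one_pow, one_lt_div hm]; exact hlt
  have hL : L = s ^ 2 * m := by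
    rw [hs_def, Real.sq_sqrt (div_pos (hm.trans hlt) hm).le, div_mul_cancel₀ _ hm.ne']
  have hsm : 0 < s - 1 := by linarith
  have hsp : 0 < s + 1 := by linarith
  have hLm : 0 < L - m := by linarith
  set ρ := (s - 1) / (s + 1) with hρ_def
  have hρ : 0 < ρ := by positivity
  -- The affine map from `[m, L]` to `[-1, 1]` sends `0` to this point, so the normalizing constant
  -- is `T_k(cosh θ) = cosh (k θ)` with `θ = -log ρ`.
  have hcosh : Real.cosh (-Real.log ρ) = (L + m) / (L - m) := by
    rw [Real.cosh_neg, Real.cosh_log hρ, hρ_def, hL]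
    have : s ^ 2 * m - m = (s - 1) * (s + 1) * m := by ring
    rw [this]
    field_simp
    ring
  have hpos : 0 < Real.cosh (k * -Real.log ρ) := Real.cosh_pos _
  refine ⟨C (Real.cosh (k * -Real.log ρ))⁻¹ *
    (Chebyshev.T ℝ k).comp (C ((L + m) / (L - m)) - C (2 / (L - m)) * X), ?_, ?_, ?_⟩
  · refine (natDegree_C_mul_le _ _).trans (natDegree_comp_le.trans ?_)
    rw [Chebyshev.natDegree_T, Int.natAbs_natCast]
    refine (Nat.mul_le_mul_left k ?_).trans (mul_one k).le
    refine (natDegree_sub_le _ _).trans ?_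
    simpa using (natDegree_C_mul_le (2 / (L - m)) X).trans natDegree_X_le
  · have hT := Chebyshev.T_real_cosh (-Real.log ρ) k
    rw [hcosh] at hT
    simp only [eval_mul, eval_C, eval_comp, eval_sub, eval_X, mul_zero, sub_zero]
    rw [hT]
    exact inv_mul_cancel₀ hpos.ne'
  · intro t h1 h2
    simp only [eval_mul, eval_C, eval_comp, eval_sub, eval_X]
    have hx : |(L + m) / (L - m) - 2 / (L - m) * t| ≤ 1 := by
      have : (L + m) / (L - m) - 2 / (L - m) * t = (L + m - 2 * t) / (L - m) := by ring
      rw [this, abs_div, abs_of_pos hLm, div_le_one hLm, abs_le]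
      constructor <;> linarith
    rw [abs_mul, abs_of_pos (inv_pos.mpr hpos)]
    calc _ ≤ (Real.cosh (k * -Real.log ρ))⁻¹ * 1 := by
          gcongr; exact abs_eval_T_le_one k hx
      _ ≤ 2 * ρ ^ k := by
          rw [mul_one]
          exact inv_le_of_inv_le₀ (by positivity) (half_pow_le_cosh hρ k)

end Polynomials

/-! ### The three conclusions -/

section Bounds

variable {n : ℕ} {A : Matrix (Fin n) (Fin n) ℝ}

theorem exists_CGTerminatesAt (hA : A.PosSemidef) {b : Fin n → ℝ} (x₀ : Fin n → ℝ)
    (hb : ∃ z, A *ᵥ z = b) :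
    ∃ k ≤ numDistinctNonzeroEigenvalues A,
      CGTerminatesAt A b x₀ k ∧ IsOptimal A b (cgIterate A b x₀ k) := by
  classical
  obtain ⟨z, hz⟩ := id hb
  have hfin : {μ : ℝ | μ ∈ spectrum ℝ A ∧ μ ≠ 0}.Finite :=
    A.finite_spectrum.subset fun _ h => h.1
  have hend : A *ᵥ (cgState A b x₀ (numDistinctNonzeroEigenvalues A)).p = 0 := by
    rw [mulVec_cgState_p_eq_zero_iff hA x₀ hb, cgState_r hA x₀ hb, ← hz, ← mulVec_sub]
    refine mulVec_eq_zero_of_dotProduct_eq_zero hA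
      (le_antisymm ?_ (dotProduct_mulVec_self_nonneg hA _))
    -- With `M = 0` the gap is at most zero, so the error lies in the kernel of `A`.
    have h := objective_cgIterate_sub_le hA x₀ hb (k := numDistinctNonzeroEigenvalues A)
      (q := residualPoly hfin.toFinset id) (M := 0)
      ((natDegree_residualPoly_le _ _).trans (Set.ncard_eq_toFinset_card _ hfin).ge)
      (by simp [eval_residualPoly]) (fun μ hμ h0 => by
        have := eval_residualPoly_eq_zero (S := hfin.toFinset) (f := id) (i := μ)
          (by simpa using ⟨hμ, h0⟩) h0
        simp only [id_eq] at this
        simp [this])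
    rw [objective_sub_optimalValue hA hz, hz] at *
    linarith
  have hex : ∃ k, A *ᵥ (cgState A b x₀ k).p = 0 := ⟨_, hend⟩
  refine ⟨Nat.find hex, Nat.find_min' hex hend,
    ⟨Nat.find_spec hex, fun j hj => Nat.find_min hex hj⟩, isOptimal_of_mulVec_eq hA ?_⟩
  have := Nat.find_spec hex
  rwa [mulVec_cgState_p_eq_zero_iff hA x₀ hb, cgState_r hA x₀ hb, sub_eq_zero] at this

lemma AreNonzeroEigenvalues.mem_iff {lam : ℕ → ℝ} (h : AreNonzeroEigenvalues A lam) (μ : ℝ) :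
    (∃ i, (1 ≤ i ∧ i ≤ A.rank) ∧ lam i = μ) ↔ μ ∈ spectrum ℝ A ∧ μ ≠ 0 := by
  have := congrArg (μ ∈ ·) h.2
  simpa [mem_spectrum_iff_isRoot_charpoly, A.charpoly_monic.ne_zero] using this

theorem objective_cgIterate_sub_le_eigenvalue_ratio (hA : A.PosSemidef) {b : Fin n → ℝ}
    (x₀ : Fin n → ℝ) (hb : ∃ z, A *ᵥ z = b) {lam : ℕ → ℝ} (hlam : AreNonzeroEigenvalues A lam)
    {k : ℕ} (hk1 : 1 ≤ k) (hk : k ≤ A.rank) :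
    objective A b (cgIterate A b x₀ k) - optimalValue A b ≤
      ((lam k - lam A.rank) / (lam k + lam A.rank)) ^ 2 *
        (objective A b x₀ - optimalValue A b) := by
  have hpos : ∀ i, 1 ≤ i → i ≤ A.rank → 0 < lam i := fun i h1 h2 => by
    obtain ⟨h, h0⟩ := (hlam.mem_iff (lam i)).mp ⟨i, ⟨h1, h2⟩, rfl⟩
    exact (nonneg_of_mem_spectrum hA h).lt_of_ne h0.symm
  have hanti : ∀ i j, 1 ≤ i → i ≤ j → j ≤ A.rank → lam j ≤ lam i := fun i j h1 h2 h3 =>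
    hlam.1 ⟨h1, h2.trans h3⟩ ⟨h1.trans h2, h3⟩ h2
  have hc := hpos A.rank (hk1.trans hk) le_rfl
  have hck := hanti k A.rank hk1 hk le_rfl
  -- The product removes `lam 1, …, lam (k - 1)` and its factors lie in `[0, 1]` at the smaller
  -- eigenvalues; the linear factor has its root at the midpoint of `[lam A.rank, lam k]`.
  refine objective_cgIterate_sub_le hA x₀ hb
    (q := residualPoly (Finset.Ico 1 k) lam *
      (1 - Polynomial.C (2 / (lam k + lam A.rank)) * Polynomial.X)) ?_ ?_ ?_
  · refine Polynomial.natDegree_mul_le.trans ?_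
    have h1 := natDegree_residualPoly_le (Finset.Ico 1 k) lam
    have h2 := natDegree_one_sub_C_mul_X_le (2 / (lam k + lam A.rank))
    rw [Nat.card_Ico] at h1
    omega
  · simp [eval_residualPoly]
  · intro μ hμ h0
    obtain ⟨j, ⟨hj1, hj⟩, rfl⟩ := (hlam.mem_iff μ).mpr ⟨hμ, h0⟩
    rw [Polynomial.eval_mul, abs_mul]
    rcases lt_or_ge j k with hjk | hkj
    · rw [eval_residualPoly_eq_zero (Finset.mem_Ico.mpr ⟨hj1, hjk⟩) h0, abs_zero, zero_mul]
      exact div_nonneg (by linarith) (by linarith)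
    · rw [← one_mul ((lam k - lam A.rank) / _)]
      refine mul_le_mul (abs_eval_residualPoly_le_one (hpos j hj1 hj) fun i hi => ?_) ?_
        (abs_nonneg _) zero_le_one
      · rw [Finset.mem_Ico] at hi
        exact hanti i j hi.1 (by omega) hj
      · simpa using abs_one_sub_le_of_mem_Icc hc (hanti j A.rank hj1 hj le_rfl)
          (hanti k j hk1 hkj hj)

theorem objective_cgIterate_sub_le_condNumber (hA : A.PosSemidef) {b : Fin n → ℝ}
    (x₀ : Fin n → ℝ) (hb : ∃ z, A *ᵥ z = b) (hA0 : A ≠ 0) (k : ℕ) :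
    objective A b (cgIterate A b x₀ k) - optimalValue A b ≤
      4 * ((√(genCondNumber A) - 1) / (√(genCondNumber A) + 1)) ^ (2 * k) *
        (objective A b x₀ - optimalValue A b) := by
  have hfin : {μ : ℝ | μ ∈ spectrum ℝ A ∧ 0 < μ}.Finite :=
    A.finite_spectrum.subset fun _ h => h.1
  have hne : {μ : ℝ | μ ∈ spectrum ℝ A ∧ 0 < μ}.Nonempty := by
    by_contra hempty
    refine hA0 (hA.1.eigenvalues_eq_zero_iff.mp (funext fun i => ?_))
    by_contra h0
    exact hempty ⟨hA.1.eigenvalues i, hA.1.eigenvalues_mem_spectrum_real i,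
      (hA.eigenvalues_nonneg i).lt_of_ne (Ne.symm h0)⟩
  obtain ⟨hmem, hm⟩ := hne.csInf_mem hfin
  have hL : ∀ μ ∈ spectrum ℝ A, μ ≤ sSup (spectrum ℝ A) := fun μ hμ =>
    le_csSup A.finite_spectrum.bddAbove hμ
  obtain ⟨q, hdeg, hq, hbound⟩ := exists_chebyshev_residual hm (hL _ hmem) k
  have := objective_cgIterate_sub_le hA x₀ hb hdeg hq fun μ hμ h0 => hbound μ
    (csInf_le hfin.bddBelow ⟨hμ, (nonneg_of_mem_spectrum hA hμ).lt_of_ne h0.symm⟩) (hL μ hμ)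
  rw [mul_pow, ← pow_mul, mul_comm k 2] at this
  rwa [show (2 : ℝ) ^ 2 = 4 by norm_num] at this

end Bounds

end ConvexQP

theorem mainTheorem12 (n : ℕ) (A : Matrix (Fin n) (Fin n) ℝ) (hA : A.PosSemidef)
    (b x₀ : Fin n → ℝ) (hb : ∃ z : Fin n → ℝ, A *ᵥ z = b) :
    -- the optimal value is a genuine, attained infimum
    IsLeast (Set.range (ConvexQP.objective A b)) (ConvexQP.optimalValue A b) ∧
    -- (i) finite termination at an optimal solution
    (∃ k ≤ ConvexQP.numDistinctNonzeroEigenvalues A,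
      ConvexQP.CGTerminatesAt A b x₀ k ∧ ConvexQP.IsOptimal A b (ConvexQP.cgIterate A b x₀ k)) ∧
    -- (ii) the eigenvalue-ratio bound
    (∀ lam : ℕ → ℝ, ConvexQP.AreNonzeroEigenvalues A lam →
      ∀ k : ℕ, 1 ≤ k → k ≤ A.rank →
        ConvexQP.objective A b (ConvexQP.cgIterate A b x₀ k) - ConvexQP.optimalValue A b ≤
          ((lam k - lam A.rank) / (lam k + lam A.rank)) ^ 2 *
            (ConvexQP.objective A b x₀ - ConvexQP.optimalValue A b)) ∧
    -- (iii) the condition-number rate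
    (A ≠ 0 → ∀ k : ℕ,
      ConvexQP.objective A b (ConvexQP.cgIterate A b x₀ k) - ConvexQP.optimalValue A b ≤
        4 * ((√(ConvexQP.genCondNumber A) - 1) / (√(ConvexQP.genCondNumber A) + 1)) ^ (2 * k) *
          (ConvexQP.objective A b x₀ - ConvexQP.optimalValue A b)) := by
  obtain ⟨z, hz⟩ := id hb
  have hopt := ConvexQP.isOptimal_of_mulVec_eq hA hz
  refine ⟨?_, ConvexQP.exists_CGTerminatesAt hA x₀ hb, ?_, ?_⟩
  · rw [hopt.optimalValue_eq]
    exact hopt.isLeast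
  · exact fun lam hlam k hk1 hk =>
      ConvexQP.objective_cgIterate_sub_le_eigenvalue_ratio hA x₀ hb hlam hk1 hk
  · exact fun hA0 k => ConvexQP.objective_cgIterate_sub_le_condNumber hA x₀ hb hA0 k
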